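/- Let $-\infty\le a<b\le\infty$, let $n\ge 1$ be an integer, and let $$\ell[f]=-\frac1w\big((pf')'+qf\big)$$ be a Sturm--Liouville expression on $(a,b)$ with real coefficients, $p,w>0$ on $(a,b)$, $p\in C^{2n-1}(a,b)$ and $q,w\in C^{2n-2}(a,b)$. Let $\ell^n$ be the $n$-fold composition of $\ell$, and write it in Lagrangian symmetric form $$w\,\ell^n[f]=\sum_{j=0}^n(-1)^j\big(a_jf^{(j)}\big)^{(j)},\qquad a_j\in C^j(a,b)\ \text{real-valued}$$ (so $a_0=0$ if $q=0$). For $1\le k\le n$ the maximal domain of $\ell^k$ is $$\mathcal D_{\max}^k=\{f:(a,b)\to\mathbb C \mid f,f',\dots,f^{(2k-1)}\in AC_{\rm loc}(a,b),\ f,\ell^k[f]\in L^2[(a,b),w]\}.$$ For $a<\alpha\le\beta<b$ put $$[f,g]_k\big|_\alpha^\beta=\int_\alpha^\beta\big(\ell^k[f]\,\overline g-\ell^k[\overline g]\,f\big)w\,dx,$$ let $[f,g]_k|_a^b$ denote its limit as $\alpha\to a^+$, $\beta\to b^-$, and let the minimal domain be $\mathcal D_{\min}^k=\{f\in\mathcal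 D_{\max}^k\mid [f,g]_k|_a^b=0\ \forall g\in\mathcal D^k_{\max}\}$. For a function $h$ on $(a,b)$, $h|_a^b=0$ means that the limits $h(a^+)$ and $h(b^-)$ exist, are finite, and are equal. Let ${\bf L}$ be a self-adjoint operator in $L^2[(a,b),w]$ that is bounded below (by some real constant) and acts by $\ell$ on a subset of $\mathcal D_{\max}^1$. Let ${\bf L}^n$ be its $n$-th power, with domain $\mathcal D^n_{\bf L}$ (the $2n$-th left-definite space of ${\bf L}$). Suppose that ${\bf L}^n$ acts by $\ell^n$ on $\mathcal D^n_{\bf L}\subseteq\mathcal D^n_{\max}$ and extends the minimal operator $\{\ell^n,\mathcal D^n_{\min}\}$, whose deficiency indices are $(n,n)$. Suppose that ${\bf L}$ has a complete orthogonal system of polynomial eigenfunctions $\{P_k\}_{k=0}^\infty$, $\deg P_k=k$. Let $\rho$ be either $p$ or $p/w$ (the two coincide when $w\equiv1$), and define $$\mathcal A_n=\{f:(a,b)\to\mathbb C \mid f,f',\dots,f^{(2n-1)}\in AC_{\rm loc}(a,b),\ \rho^nf^{(2n)}\in L^2[(a,b),w]\},$$ $$\mathcal B_n=\{f\in\mathcal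 D^n_{\max}\mid [f,P_j]_n|_a^b=0,\ j=0,\dots,n-1\},$$ $$\mathcal F_n=\{f\in\mathcal D^n_{\max}\mid (a_jf^{(j)})^{(j-1)}|_a^b=0,\ j=1,\dots,n\}.$$ Suppose that $\mathcal D^n_{\bf L}=\mathcal A_n$ and $\mathcal A_n=\mathcal B_n$. Then $\mathcal B_n\subseteq\mathcal F_n$. -/

import Mathlib

open MeasureTheory Filter Topology Polynomial

noncomputable section

/-- Data of a Sturm--Liouville expression
`ℓ[f] = -(1/w) ((p f')' + q f)` on the interval `(a,b)`, `-∞ ≤ a < b ≤ ∞`.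
Only the values of `p, q, w` on `(a,b)` matter. -/
structure SLExpr where
  a : EReal
  b : EReal
  p : ℝ → ℝ
  q : ℝ → ℝ
  w : ℝ → ℝ

namespace SLExpr

/-- The open interval `(a,b)` of the real line. -/
def I (S : SLExpr) : Set ℝ := {x : ℝ | S.a < (x : EReal) ∧ (x : EReal) < S.b}

/-- `x → a⁺`. -/
def atA (S : SLExpr) : Filter ℝ := comap (fun x : ℝ => (x : EReal)) (𝓝[>] S.a)

/-- `x → b⁻`. -/
def atB (S : SLExpr) : Filter ℝ := comap (fun x : ℝ => (x : EReal)) (𝓝[<] S.b)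

/-- The interval is nondegenerate, `p, w > 0` and `p, q, w` have the smoothness on `(a,b)` which the
`n`-fold composition of `ℓ` needs to be a differential expression of order `2n` with continuous
coefficients. -/
structure IsRegular (S : SLExpr) (n : ℕ) : Prop where
  lt : S.a < S.b
  p_pos : ∀ x ∈ S.I, 0 < S.p x
  w_pos : ∀ x ∈ S.I, 0 < S.w x
  p_smooth : ContDiffOn ℝ ((2 * n - 1 : ℕ) : WithTop ℕ∞) S.p S.I
  q_smooth : ContDiffOn ℝ ((2 * n - 2 : ℕ) : WithTop ℕ∞) S.q S.I
  w_smooth : ContDiffOn ℝ ((2 * n - 2 : ℕ) : WithTop ℕ∞) S.w S.I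

/-- The measure `w(x) dx` on `(a,b)`. -/
def μ (S : SLExpr) : Measure ℝ :=
  (volume.restrict S.I).withDensity (fun x => ENNReal.ofReal (S.w x))

/-- The Hilbert space `L²[(a,b), w]`. -/
abbrev H (S : SLExpr) : Type := Lp ℂ 2 S.μ

/-- The expression `ℓ[f] = -(1/w) ((p f')' + q f)`. -/
def ell (S : SLExpr) (f : ℝ → ℂ) (x : ℝ) : ℂ :=
  -(1 / (S.w x : ℂ)) * (deriv (fun y => (S.p y : ℂ) * deriv f y) x + (S.q x : ℂ) * f x)

/-- The `n`-fold composition `ℓⁿ`. -/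
def ellPow (S : SLExpr) (n : ℕ) (f : ℝ → ℂ) : ℝ → ℂ := (S.ell)^[n] f

/-- `f ∈ AC_loc(a,b)`. -/
def ACloc (S : SLExpr) (f : ℝ → ℂ) : Prop :=
  ∀ α ∈ S.I, ∀ β ∈ S.I, AbsolutelyContinuousOnInterval f α β

/-- `f, f', …, f^(2n-1) ∈ AC_loc(a,b)`. -/
def Admissible (S : SLExpr) (n : ℕ) (f : ℝ → ℂ) : Prop :=
  ∀ k < 2 * n, S.ACloc (iteratedDeriv k f)

/-- The maximal domain of `ℓⁿ`. Here and below, membership of `f` only depends on `f` on `(a,b)`. -/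
def Dmax (S : SLExpr) (n : ℕ) : Set (ℝ → ℂ) :=
  {f | S.Admissible n f ∧ MemLp f 2 S.μ ∧ MemLp (S.ellPow n f) 2 S.μ}

/-- The sesquilinear form `[f,g]_n |_α^β`, by Green's formula. -/
def sesq (S : SLExpr) (n : ℕ) (f g : ℝ → ℂ) (α β : ℝ) : ℂ :=
  ∫ x in α..β, (S.ellPow n f x * (starRingEnd ℂ) (g x)
    - S.ellPow n (fun y => (starRingEnd ℂ) (g y)) x * f x) * (S.w x : ℂ)

/-- `[f,g]_n |_a^b = 0`: the form `[f,g]_n |_α^β` tends to `0` as `α → a⁺` and `β → b⁻`. -/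
def SesqVanishes (S : SLExpr) (n : ℕ) (f g : ℝ → ℂ) : Prop :=
  Tendsto (fun z : ℝ × ℝ => S.sesq n f g z.1 z.2) (S.atA ×ˢ S.atB) (𝓝 0)

/-- `h |_a^b = 0`: the limits of `h` at `a⁺` and at `b⁻` exist in `ℂ` and their difference is `0`. -/
def BdryVanishes (S : SLExpr) (h : ℝ → ℂ) : Prop :=
  ∃ c_a c_b : ℂ, Tendsto h S.atA (𝓝 c_a) ∧ Tendsto h S.atB (𝓝 c_b) ∧ c_b - c_a = 0

/-- The minimal domain of `ℓⁿ`. -/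
def Dmin (S : SLExpr) (n : ℕ) : Set (ℝ → ℂ) :=
  {f | f ∈ S.Dmax n ∧ ∀ g ∈ S.Dmax n, S.SesqVanishes n f g}

/-- The operator `{ℓⁿ, X}` in `L²[(a,b), w]`, as a graph: the pairs of classes of `f` and `ℓⁿ[f]`,
for `f ∈ X`. -/
def opGraph (S : SLExpr) (n : ℕ) (X : Set (ℝ → ℂ)) : Set (S.H × S.H) :=
  {z | ∃ f ∈ X, z.1 =ᵐ[S.μ] f ∧ z.2 =ᵐ[S.μ] S.ellPow n f}

/-- The deficiency indices of the minimal operator `{ℓⁿ, Dmin}`, whose adjoint is the maximal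
operator `{ℓⁿ, Dmax}`, are `(m,m)`: the spaces of `u` in the domain of the maximal operator that it
maps to `i u`, respectively `-i u`, have dimension `m`.
(These sets are subspaces already; `span` only bundles them.) -/
def HasDeficiencyIndices (S : SLExpr) (n m : ℕ) : Prop :=
  Module.rank ℂ (Submodule.span ℂ {u : S.H | (u, Complex.I • u) ∈ S.opGraph n (S.Dmax n)}) = m ∧
  Module.rank ℂ (Submodule.span ℂ {u : S.H | (u, -Complex.I • u) ∈ S.opGraph n (S.Dmax n)}) = m

/-- The graph of the power `Lⁿ` (composition of unbounded operators with natural domain). -/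
def powGraph (S : SLExpr) (L : S.H →ₗ.[ℂ] S.H) : ℕ → Set (S.H × S.H)
  | 0 => {z | z.1 = z.2}
  | n + 1 => {z | ∃ u : S.H, (z.1, u) ∈ powGraph S L n ∧ (u, z.2) ∈ L.graph}

/-- `L` is bounded below: `⟨L u, u⟩ ≥ k ⟨u, u⟩` for some real `k`. -/
def IsBoundedBelow (S : SLExpr) (L : S.H →ₗ.[ℂ] S.H) : Prop :=
  ∃ k : ℝ, ∀ u : L.domain, k * ‖(u : S.H)‖ ^ 2 ≤ RCLike.re (inner ℂ (L u) (u : S.H))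

/-- The domain of `Lⁿ` (which is the `2n`-th left-definite space of `L`), as a subset of the
maximal domain of `ℓⁿ`. -/
def powDomain (S : SLExpr) (L : S.H →ₗ.[ℂ] S.H) (n : ℕ) : Set (ℝ → ℂ) :=
  {f | f ∈ S.Dmax n ∧ ∃ u v : S.H, u =ᵐ[S.μ] f ∧ (u, v) ∈ S.powGraph L n}

/-- `Lⁿ` is the `n`-th power, in the sense of left-definite theory, of a self-adjoint realization `L`
of `ℓ` that is bounded below; `Lⁿ` acts by `ℓⁿ` and extends the minimal operator of `ℓⁿ`, whose
deficiency indices are `(n,n)`. -/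
structure IsLeftDefinitePower (S : SLExpr) (L : S.H →ₗ.[ℂ] S.H) (n : ℕ) : Prop where
  selfAdjoint : IsSelfAdjoint L
  boundedBelow : S.IsBoundedBelow L
  acts : (L.graph : Set (S.H × S.H)) ⊆ S.opGraph 1 (S.Dmax 1)
  pow_acts : S.powGraph L n ⊆ S.opGraph n (S.Dmax n)
  extends_min : S.opGraph n (S.Dmin n) ⊆ S.powGraph L n
  deficiency : S.HasDeficiencyIndices n n

/-- A polynomial as a complex-valued function of a real variable. -/
def polyFun (P : ℂ[X]) (x : ℝ) : ℂ := P.eval (x : ℂ)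

/-- `(P_k)`, with `deg P_k = k`, is a complete orthogonal system of polynomials in `L²[(a,b), w]`
consisting of eigenfunctions of `L`. -/
def IsPolynomialEigensystem (S : SLExpr) (L : S.H →ₗ.[ℂ] S.H) (P : ℕ → ℂ[X]) : Prop :=
  (∀ k, (P k).degree = (k : WithBot ℕ)) ∧
  ∃ e : ℕ → S.H,
    (∀ k, e k =ᵐ[S.μ] polyFun (P k)) ∧
    (∀ k, ∃ lam : ℂ, (e k, lam • e k) ∈ L.graph) ∧
    Pairwise (fun i j => inner ℂ (e i) (e j) = 0) ∧
    (Submodule.span ℂ (Set.range e)).topologicalClosure = ⊤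

/-- `A_j`, `0 ≤ j ≤ n`, are the coefficients of the Lagrangian symmetric form of `ℓⁿ`:
`w ℓⁿ[f] = ∑ (-1)^j (A_j f^(j))^(j)`. -/
def IsLagrangianForm (S : SLExpr) (n : ℕ) (A : ℕ → ℝ → ℝ) : Prop :=
  (∀ j ≤ n, ContDiffOn ℝ (j : WithTop ℕ∞) (A j) S.I) ∧
  ∀ f, S.Admissible n f → ∀ᵐ x ∂(volume.restrict S.I),
    (S.w x : ℂ) * S.ellPow n f x =
      ∑ j ∈ Finset.range (n + 1),
        (-1) ^ j * iteratedDeriv j (fun y => (A j y : ℂ) * iteratedDeriv j f y) x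

/-- The set `𝒜_n`, with the factor `ρ^n` in front of `f^(2n)`. -/
def setA (S : SLExpr) (n : ℕ) (ρ : ℝ → ℝ) : Set (ℝ → ℂ) :=
  {f | S.Admissible n f ∧ MemLp (fun x => (ρ x : ℂ) ^ n * iteratedDeriv (2 * n) f x) 2 S.μ}

/-- The set `ℬ_n`: GKN conditions given by `P_0, …, P_{n-1}`. -/
def setB (S : SLExpr) (n : ℕ) (P : ℕ → ℂ[X]) : Set (ℝ → ℂ) :=
  {f | f ∈ S.Dmax n ∧ ∀ j < n, S.SesqVanishes n f (polyFun (P j))}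

/-- The set `ℱ_n`: `(A_j f^(j))^(j-1) |_a^b = 0` for `j = 1, …, n`. -/
def setF (S : SLExpr) (n : ℕ) (A : ℕ → ℝ → ℝ) : Set (ℝ → ℂ) :=
  {f | f ∈ S.Dmax n ∧ ∀ j ∈ Finset.Icc 1 n,
    S.BdryVanishes (iteratedDeriv (j - 1) (fun y => (A j y : ℂ) * iteratedDeriv j f y))}

end SLExpr

end

/-! The eigenvalue equations of degrees 0, 1, 2 force `ℓ` to be of hypergeometric type: `q = -λw`,
`p' = τw`, `p = σw` with polynomials `τ`, `σ` of degree at most 1, 2. Hence `ℓ = λ - M` with `M =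
σD² + τD`, and the Leibniz rule gives `(σ^(j+1) w f^(j+1))' = σ^j w ((M - μ_j) f)^(j)`, where `μ_j`
is the eigenvalue of `M` in degree `j` (`deriv_rodrigues`).

Iterated on polynomials, this identity turns the Newton expansion of `(λ - X)^n` at the nodes `μ_j`
into a Lagrangian form of `ℓⁿ`; uniqueness of that form gives `a_j = d_j σ^j w` with constants `d_j`
(`exists_lagrangian_coeff`).

Iterated on `f` in the domain of `Lⁿ`, it gives `(σ^j w f^(j))^(j-1) = p g'`, where `g` is a product
of factors `λ - μ_i - L` applied to `f` and lies in the domain of `L`. Since the constant `1` is an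
eigenfunction for `λ`, the integral of `(p g')' = w(λ - ℓ)g` is `⟨1, (λ - L)g⟩ = 0`, so `p g'` has
equal limits at both ends (`bdryVanishes_p_mul_deriv`). The hypotheses on `𝒜_n` and `ℬ_n` serve to
place `f` in the domain of `Lⁿ`. -/

noncomputable section

/-! ### Absolute continuity of complex-valued functions -/

theorem LipschitzWith.comp_absolutelyContinuousOnInterval {X Y : Type*} [PseudoMetricSpace X]
    [PseudoMetricSpace Y] {φ : X → Y} (hφ : LipschitzWith 1 φ) {f : ℝ → X} {a b : ℝ}
    (hf : AbsolutelyContinuousOnInterval f a b) :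
    AbsolutelyContinuousOnInterval (fun x => φ (f x)) a b := by
  refine squeeze_zero (fun t => Finset.sum_nonneg fun i _ => dist_nonneg)
    (fun t => Finset.sum_le_sum fun i _ => ?_) hf
  simpa using hφ.dist_le_mul (f (t.2 i).1) (f (t.2 i).2)

theorem AbsolutelyContinuousOnInterval.intervalIntegral_deriv_complex {f : ℝ → ℂ} {a b : ℝ}
    (hf : AbsolutelyContinuousOnInterval f a b) :
    IntervalIntegrable (deriv f) volume a b ∧ ∫ x in a..b, deriv f x = f b - f a := by
  have hre : AbsolutelyContinuousOnInterval (fun x => (f x).re) a b :=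
    (LipschitzWith.of_dist_le_mul fun x y => by
      simpa [dist_eq_norm] using Complex.abs_re_le_norm (x - y)).comp_absolutelyContinuousOnInterval
      (φ := Complex.re) hf
  have him : AbsolutelyContinuousOnInterval (fun x => (f x).im) a b :=
    (LipschitzWith.of_dist_le_mul fun x y => by
      simpa [dist_eq_norm] using Complex.abs_im_le_norm (x - y)).comp_absolutelyContinuousOnInterval
      (φ := Complex.im) hf
  have hre' : IntervalIntegrable (fun x => ((deriv (fun x => (f x).re) x : ℝ) : ℂ)) volume a b :=
    ⟨hre.intervalIntegrable_deriv.1.ofReal, hre.intervalIntegrable_deriv.2.ofReal⟩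
  have him' : IntervalIntegrable (fun x => ((deriv (fun x => (f x).im) x : ℝ) : ℂ)) volume a b :=
    ⟨him.intervalIntegrable_deriv.1.ofReal, him.intervalIntegrable_deriv.2.ofReal⟩
  have hI : IntervalIntegrable (fun x => ((deriv (fun x => (f x).re) x : ℝ) : ℂ) +
      ((deriv (fun x => (f x).im) x : ℝ) : ℂ) * Complex.I) volume a b :=
    hre'.add (him'.mul_const _)
  have hae : ∀ᵐ x, x ∈ Set.uIcc a b → ((deriv (fun x => (f x).re) x : ℝ) : ℂ) +
      ((deriv (fun x => (f x).im) x : ℝ) : ℂ) * Complex.I = deriv f x := by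
    filter_upwards [hre.ae_differentiableAt, him.ae_differentiableAt] with x h1 h2 hx
    have := (h1 hx).hasDerivAt.ofReal_comp.add ((h2 hx).hasDerivAt.ofReal_comp.mul_const Complex.I)
    refine (HasDerivAt.deriv (this.congr_of_eventuallyEq ?_)).symm
    exact Eventually.of_forall fun y => (Complex.re_add_im (f y)).symm
  have hae' : ∀ᵐ x, x ∈ Set.uIoc a b → ((deriv (fun x => (f x).re) x : ℝ) : ℂ) +
      ((deriv (fun x => (f x).im) x : ℝ) : ℂ) * Complex.I = deriv f x := by
    filter_upwards [hae] with x hx h using hx (Set.uIoc_subset_uIcc h)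
  refine ⟨hI.congr_ae ((ae_restrict_iff' measurableSet_uIoc).2 hae'), ?_⟩
  rw [← intervalIntegral.integral_congr_ae hae', intervalIntegral.integral_add
    hre' (him'.mul_const _),
    intervalIntegral.integral_mul_const, intervalIntegral.integral_ofReal,
    intervalIntegral.integral_ofReal, hre.integral_deriv_eq_sub, him.integral_deriv_eq_sub]
  apply Complex.ext <;> simp

/-! ### The interval, its ends, and local absolute continuity -/

namespace SLExpr

variable {S : SLExpr}

theorem isOpen_I (S : SLExpr) : IsOpen S.I :=
  (isOpen_lt continuous_const continuous_coe_real_ereal).inter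
    (isOpen_lt continuous_coe_real_ereal continuous_const)

theorem ordConnected_I (S : SLExpr) : S.I.OrdConnected :=
  ⟨fun _ hx _ hy _ hz => ⟨hx.1.trans_le (EReal.coe_le_coe_iff.2 hz.1),
    (EReal.coe_le_coe_iff.2 hz.2).trans_lt hy.2⟩⟩

theorem IsRegular.nonempty_I {n : ℕ} (hS : S.IsRegular n) : S.I.Nonempty := by
  obtain ⟨x, h1, h2⟩ := EReal.lt_iff_exists_real_btwn.1 hS.lt
  exact ⟨x, h1, h2⟩

theorem eventually_atA {x : ℝ} (hx : x ∈ S.I) : ∀ᶠ y in S.atA, y ∈ S.I ∧ y ≤ x := by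
  have : Set.Ioo S.a (x : EReal) ∈ 𝓝[>] S.a := Ioo_mem_nhdsGT hx.1
  filter_upwards [preimage_mem_comap this] with y hy
  exact ⟨⟨hy.1, hy.2.trans hx.2⟩, EReal.coe_le_coe_iff.1 hy.2.le⟩

theorem eventually_atB {x : ℝ} (hx : x ∈ S.I) : ∀ᶠ y in S.atB, y ∈ S.I ∧ x ≤ y := by
  have : Set.Ioo (x : EReal) S.b ∈ 𝓝[<] S.b := Ioo_mem_nhdsLT hx.2
  filter_upwards [preimage_mem_comap this] with y hy
  exact ⟨⟨hx.1.trans hy.1, hy.2⟩, EReal.coe_le_coe_iff.1 hy.1.le⟩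

theorem BdryVanishes.congr (hI : S.I.Nonempty) {h k : ℝ → ℂ} (hh : S.BdryVanishes h)
    (e : Set.EqOn h k S.I) : S.BdryVanishes k := by
  obtain ⟨x, hx⟩ := hI
  obtain ⟨c, d, h1, h2, h3⟩ := hh
  exact ⟨c, d, h1.congr' ((eventually_atA hx).mono fun y hy => e hy.1),
    h2.congr' ((eventually_atB hx).mono fun y hy => e hy.1), h3⟩

theorem BdryVanishes.const_mul {h : ℝ → ℂ} (hh : S.BdryVanishes h) (c : ℂ) :
    S.BdryVanishes (fun x => c * h x) := by
  obtain ⟨a, b, h1, h2, h3⟩ := hh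
  exact ⟨c * a, c * b, h1.const_mul c, h2.const_mul c, by rw [← mul_sub, h3, mul_zero]⟩

theorem ACloc.continuousOn {f : ℝ → ℂ} (hf : S.ACloc f) : ContinuousOn f S.I := by
  intro x hx
  obtain ⟨ε, hε, h⟩ := Metric.isOpen_iff.1 S.isOpen_I x hx
  have h1 : x - ε / 2 ∈ S.I := h (by simp [abs_of_pos hε]; linarith)
  have h2 : x + ε / 2 ∈ S.I := h (by simp [abs_of_pos hε]; linarith)
  have := (hf _ h1 _ h2).continuousOn
  rw [Set.uIcc_of_le (by linarith)] at this
  exact (this.continuousAt (Icc_mem_nhds (by linarith) (by linarith))).continuousWithinAt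

/-- `f` is the integral of its continuous derivative, so differentiability holds everywhere and not
just almost everywhere. -/
theorem ACloc.differentiableOn {f : ℝ → ℂ} (hf : S.ACloc f) (hf' : ContinuousOn (deriv f) S.I) :
    DifferentiableOn ℝ f S.I := by
  intro x hx
  have hd := intervalIntegral.integral_hasDerivAt_right (a := x) (b := x) (f := deriv f)
    (by simp) (hf'.stronglyMeasurableAtFilter S.isOpen_I x hx)
    (hf'.continuousAt (S.isOpen_I.mem_nhds hx))
  refine DifferentiableAt.differentiableWithinAt ?_
  refine (hd.const_add (f x)).differentiableAt.congr_of_eventuallyEq ?_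
  filter_upwards [S.isOpen_I.mem_nhds hx] with y hy
  rw [(hf x hx y hy).intervalIntegral_deriv_complex.2]
  ring

theorem contDiffOn_of_ACloc (m : ℕ) {f : ℝ → ℂ} (hf : ∀ k ≤ m, S.ACloc (iteratedDeriv k f)) :
    ContDiffOn ℝ m f S.I := by
  induction m generalizing f with
  | zero => simpa using (hf 0 le_rfl).continuousOn
  | succ m ih =>
    have h0 : S.ACloc f := by simpa using hf 0 (Nat.zero_le _)
    have h1 : S.ACloc (deriv f) := by simpa using hf 1 (by omega)
    push_cast
    rw [contDiffOn_succ_iff_deriv_of_isOpen S.isOpen_I]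
    refine ⟨h0.differentiableOn h1.continuousOn, by simp, ih fun k hk => ?_⟩
    rw [← iteratedDeriv_succ']
    exact hf _ (by omega)

theorem Admissible.contDiffOn {n : ℕ} (hn : 1 ≤ n) {f : ℝ → ℂ} (hf : S.Admissible n f) :
    ContDiffOn ℝ ((2 * n - 1 : ℕ) : WithTop ℕ∞) f S.I :=
  contDiffOn_of_ACloc _ fun k hk => hf k (by omega)

theorem _root_.ContDiffOn.ACloc {f : ℝ → ℂ} (hf : ContDiffOn ℝ 1 f S.I) : S.ACloc f :=
  fun _ hα _ hβ => (hf.mono (S.ordConnected_I.uIcc_subset hα hβ)).absolutelyContinuousOnInterval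

theorem ACloc.mul {f g : ℝ → ℂ} (hf : S.ACloc f) (hg : S.ACloc g) :
    S.ACloc (fun x => f x * g x) :=
  fun α hα β hβ => (hf α hα β hβ).fun_smul (hg α hα β hβ)

/-- Integrability of `F'` makes `F x₀ + ∫ F'` converge at each end; the two limits differ by the
integral of `F'` over the whole interval. -/
theorem bdryVanishes_of_integral_deriv_eq_zero (hI : S.I.Nonempty) {F : ℝ → ℂ} (hF : S.ACloc F)
    (hi : IntegrableOn (deriv F) S.I) (h0 : ∫ x in S.I, deriv F x = 0) : S.BdryVanishes F := by
  obtain ⟨x₀, hx₀⟩ := hI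
  have key : ∀ x ∈ S.I, F x = F x₀ + ∫ t in x₀..x, deriv F t := fun x hx => by
    rw [(hF x₀ hx₀ x hx).intervalIntegral_deriv_complex.2]; ring
  have hatA : S.atA.IsCountablyGenerated := by unfold atA; infer_instance
  have hatB : S.atB.IsCountablyGenerated := by unfold atB; infer_instance
  have hIm := S.isOpen_I.measurableSet
  have cB : AECover (volume.restrict (S.I ∩ Set.Ioi x₀)) S.atB (fun x => Set.Iic x) :=
    ⟨(ae_restrict_mem (hIm.inter measurableSet_Ioi)).mono fun y hy =>
      (eventually_atB hy.1).mono fun z hz => hz.2, fun _ => measurableSet_Iic⟩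
  have cA : AECover (volume.restrict (S.I ∩ Set.Iic x₀)) S.atA (fun x => Set.Ioi x) := by
    refine ⟨(ae_restrict_mem (hIm.inter measurableSet_Iic)).mono fun y hy => ?_,
      fun _ => measurableSet_Ioi⟩
    obtain ⟨ε, hε, h⟩ := Metric.isOpen_iff.1 S.isOpen_I y hy.1
    have h1 : y - ε / 2 ∈ S.I := h (by simp [abs_of_pos hε]; linarith)
    refine (eventually_atA h1).mono fun z hz => ?_
    have := hz.2
    simp only [Set.mem_Ioi]
    linarith
  have tB := cB.integral_tendsto_of_countably_generated (hi.mono_set Set.inter_subset_left)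
  have tA := cA.integral_tendsto_of_countably_generated (hi.mono_set Set.inter_subset_left)
  refine ⟨_, _, ((tA.const_sub (F x₀)).congr' ?_), ((tB.const_add (F x₀)).congr' ?_), ?_⟩
  · filter_upwards [eventually_atA hx₀] with x hx
    rw [key x hx.1, Measure.restrict_restrict measurableSet_Ioi,
      intervalIntegral.integral_of_ge hx.2, sub_eq_add_neg]
    congr 4
    ext y
    refine ⟨fun h => ⟨h.1, h.2.2⟩, fun h => ⟨h.1, ?_, h.2⟩⟩
    exact S.ordConnected_I.out hx.1 hx₀ ⟨h.1.le, h.2⟩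
  · filter_upwards [eventually_atB hx₀] with x hx
    rw [key x hx.1, Measure.restrict_restrict measurableSet_Iic,
      intervalIntegral.integral_of_le hx.2]
    congr 3
    ext y
    refine ⟨fun h => ⟨h.2.2, h.1⟩, fun h => ⟨h.2, ?_, h.1⟩⟩
    exact S.ordConnected_I.out hx₀ hx.1 ⟨h.1.le, h.2⟩
  · have : (∫ x in S.I ∩ Set.Ioi x₀, deriv F x) + ∫ x in S.I ∩ Set.Iic x₀, deriv F x = 0 := by
      rw [← h0, ← setIntegral_union]
      · rw [← Set.inter_union_distrib_left, Set.Ioi_union_Iic, Set.inter_univ]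
      · exact Set.disjoint_left.2 fun y h1 h2 => absurd h1.2 (not_lt.2 (show y ≤ x₀ from h2.2))
      · exact hIm.inter measurableSet_Iic
      · exact hi.mono_set Set.inter_subset_left
      · exact hi.mono_set Set.inter_subset_left
    linear_combination this

end SLExpr

/-! ### Iterated derivatives, polynomials and the operator `σD² + τD` -/

theorem ContDiffOn.iteratedDeriv_of_isOpen {f : ℝ → ℂ} {U : Set ℝ} (hU : IsOpen U) (k r : ℕ)
    (hf : ContDiffOn ℝ ((k + r : ℕ) : WithTop ℕ∞) f U) : ContDiffOn ℝ r (iteratedDeriv k f) U := by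
  induction k generalizing f with
  | zero => simpa using hf
  | succ k ih =>
    rw [iteratedDeriv_succ']
    exact ih (hf.deriv_of_isOpen hU (by norm_cast; omega))

theorem ContDiffOn.hasDerivAt_iteratedDeriv {f : ℝ → ℂ} {U : Set ℝ} (hU : IsOpen U) {m k : ℕ}
    (hf : ContDiffOn ℝ m f U) (hk : k < m) {x : ℝ} (hx : x ∈ U) :
    HasDerivAt (iteratedDeriv k f) (iteratedDeriv (k + 1) f x) x := by
  rw [iteratedDeriv_succ]
  have : ContDiffOn ℝ (1 : ℕ) (iteratedDeriv k f) U :=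
    ContDiffOn.iteratedDeriv_of_isOpen hU k 1 (hf.of_le (by norm_cast))
  exact ((this.differentiableOn (by simp)).differentiableAt (hU.mem_nhds hx)).hasDerivAt

namespace SLExpr

theorem hasDerivAt_polyFun (Q : ℂ[X]) (x : ℝ) :
    HasDerivAt (polyFun Q) (polyFun Q.derivative x) x :=
  (Q.hasDerivAt (x : ℂ)).comp_ofReal

theorem deriv_polyFun (Q : ℂ[X]) : deriv (polyFun Q) = polyFun Q.derivative :=
  funext fun x => (hasDerivAt_polyFun Q x).deriv

theorem iteratedDeriv_polyFun (k : ℕ) (Q : ℂ[X]) :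
    iteratedDeriv k (polyFun Q) = polyFun (derivative^[k] Q) := by
  induction k generalizing Q with
  | zero => simp
  | succ k ih => rw [iteratedDeriv_succ', deriv_polyFun, ih, Function.iterate_succ_apply]

theorem contDiff_polyFun (n : WithTop ℕ∞) (Q : ℂ[X]) : ContDiff ℝ n (polyFun Q) :=
  (Q.contDiff_aeval (𝕜 := ℂ) n |>.restrict_scalars ℝ).comp Complex.ofRealCLM.contDiff

theorem continuous_polyFun (Q : ℂ[X]) : Continuous (polyFun Q) :=
  (contDiff_polyFun 0 Q).continuous

/-- The differential operator `f ↦ σ f'' + τ f' - m f` with polynomial coefficients `σ`, `τ`. -/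
def hyperOp (σ τ : ℂ[X]) (m : ℂ) (f : ℝ → ℂ) (x : ℝ) : ℂ :=
  polyFun σ x * deriv (deriv f) x + polyFun τ x * deriv f x - m * f x

/-- The operator `Q ↦ σ Q'' + τ Q'` on polynomials. -/
def polyHyper (σ τ : ℂ[X]) : ℂ[X] →ₗ[ℂ] ℂ[X] :=
  (LinearMap.mulLeft ℂ σ) ∘ₗ derivative ∘ₗ derivative + (LinearMap.mulLeft ℂ τ) ∘ₗ derivative

theorem polyHyper_apply (σ τ Q : ℂ[X]) :
    polyHyper σ τ Q = σ * derivative (derivative Q) + τ * derivative Q := rfl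

theorem hyperOp_polyFun (σ τ : ℂ[X]) (m : ℂ) (Q : ℂ[X]) :
    hyperOp σ τ m (polyFun Q) = polyFun (polyHyper σ τ Q - C m * Q) := by
  funext x
  simp [hyperOp, deriv_polyFun, polyHyper_apply, polyFun]

theorem contDiffOn_hyperOp {σ τ : ℂ[X]} {m : ℂ} {U : Set ℝ} (hU : IsOpen U) {r : ℕ} {f : ℝ → ℂ}
    (hf : ContDiffOn ℝ ((r + 2 : ℕ) : WithTop ℕ∞) f U) : ContDiffOn ℝ r (hyperOp σ τ m f) U := by
  have h1 : ContDiffOn ℝ ((r + 1 : ℕ) : WithTop ℕ∞) (deriv f) U :=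
    hf.deriv_of_isOpen hU (by norm_cast)
  have h2 : ContDiffOn ℝ r (deriv (deriv f)) U := h1.deriv_of_isOpen hU (by norm_cast)
  exact (((contDiff_polyFun _ σ).contDiffOn.mul h2).add
    ((contDiff_polyFun _ τ).contDiffOn.mul (h1.of_le (by norm_cast; omega)))).sub
    (contDiffOn_const.mul (hf.of_le (by norm_cast; omega)))

/-- The Leibniz rule stops at `σ''` and `τ'`, which are constant. -/
theorem iteratedDeriv_hyperOp {σ τ : ℂ[X]} {s t : ℂ} (hσ : derivative (derivative σ) = C s)
    (hτ : derivative τ = C t) (m : ℂ) {U : Set ℝ} (hU : IsOpen U) (j : ℕ) {f : ℝ → ℂ}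
    (hf : ContDiffOn ℝ ((j + 2 : ℕ) : WithTop ℕ∞) f U) :
    Set.EqOn (iteratedDeriv j (hyperOp σ τ m f)) (fun x => polyFun σ x * iteratedDeriv (j + 2) f x
      + (j * polyFun (derivative σ) x + polyFun τ x) * iteratedDeriv (j + 1) f x
      + (j.choose 2 * s + j * t - m) * iteratedDeriv j f x) U := by
  induction j with
  | zero =>
    intro x _
    simp [hyperOp, iteratedDeriv_succ]
    ring
  | succ j ih =>
    intro x hx
    have e := ih (hf.of_le (by norm_cast; omega))
    rw [iteratedDeriv_succ, (e.eventuallyEq_of_mem (hU.mem_nhds hx)).deriv_eq]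
    have hs : polyFun (derivative (derivative σ)) x = s := by simp [hσ, polyFun]
    have ht : polyFun (derivative τ) x = t := by simp [hτ, polyFun]
    have d2 := hf.hasDerivAt_iteratedDeriv hU (k := j + 2) (by omega) hx
    have d1 := hf.hasDerivAt_iteratedDeriv hU (k := j + 1) (by omega) hx
    have d0 := hf.hasDerivAt_iteratedDeriv hU (k := j) (by omega) hx
    have := (((hasDerivAt_polyFun σ x).mul d2).add
      ((((hasDerivAt_polyFun (derivative σ) x).const_mul (j : ℂ)).add
        (hasDerivAt_polyFun τ x)).mul d1)).add (d0.const_mul (j.choose 2 * s + j * t - m))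
    refine (this.deriv).trans ?_
    simp only [hs, ht, Nat.choose_succ_succ' j 1, Nat.choose_one_right, Pi.add_apply]
    push_cast
    ring

/-! ### The Rodrigues-type identity -/

/-- The eigenvalue of `σ D² + τ D` on polynomials of degree `j`, where `σ'' = s`, `τ' = t`. -/
def hyperEig (s t : ℂ) (j : ℕ) : ℂ := j.choose 2 * s + j * t

/-- `ℓ` is of hypergeometric type: `p = σ w` and `p' = τ w` for polynomials `σ`, `τ` with `σ''` and
`τ'` constant, and `q` is a multiple of `w`. -/
structure IsHypergeometric (S : SLExpr) (σ τ : ℂ[X]) (s t lam : ℂ) : Prop where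
  deriv_deriv_sigma : derivative (derivative σ) = C s
  deriv_tau : derivative τ = C t
  p_eq : ∀ x ∈ S.I, (S.p x : ℂ) = polyFun σ x * S.w x
  deriv_p : ∀ x ∈ S.I, HasDerivAt (fun y => (S.p y : ℂ)) (polyFun τ x * S.w x) x
  q_eq : ∀ x ∈ S.I, (S.q x : ℂ) = -lam * S.w x

variable {S : SLExpr} {σ τ : ℂ[X]} {s t lam : ℂ}

/-- The function `σ^j w f^(j)`. -/
def rodrigues (S : SLExpr) (σ : ℂ[X]) (j : ℕ) (f : ℝ → ℂ) (x : ℝ) : ℂ :=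
  polyFun σ x ^ j * S.w x * iteratedDeriv j f x

/-- The shift `hyperEig s t j` cancels the zero-order term of `iteratedDeriv_hyperOp`; the other
terms are the product rule for `σ^j p f^(j+1)`. -/
theorem IsHypergeometric.deriv_rodrigues (h : S.IsHypergeometric σ τ s t lam) (j : ℕ) {f : ℝ → ℂ}
    (hf : ContDiffOn ℝ ((j + 2 : ℕ) : WithTop ℕ∞) f S.I) :
    Set.EqOn (deriv (S.rodrigues σ (j + 1) f))
      (S.rodrigues σ j (hyperOp σ τ (hyperEig s t j) f)) S.I := by
  intro x hx
  have hU := S.isOpen_I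
  -- Absorbing one factor `σw` into `p` avoids differentiating `w`.
  have e : Set.EqOn (S.rodrigues σ (j + 1) f)
      (fun y => polyFun σ y ^ j * S.p y * iteratedDeriv (j + 1) f y) S.I := fun y hy => by
    simp only [rodrigues, h.p_eq y hy]; ring
  rw [(e.eventuallyEq_of_mem (hU.mem_nhds hx)).deriv_eq, rodrigues,
    iteratedDeriv_hyperOp h.deriv_deriv_sigma h.deriv_tau _ hU j hf hx]
  have d1 := hf.hasDerivAt_iteratedDeriv hU (k := j + 1) (by omega) hx
  refine ((((hasDerivAt_polyFun σ x).pow j).mul (h.deriv_p x hx)).mul d1).deriv.trans ?_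
  simp only [Pi.mul_apply, Pi.pow_apply, h.p_eq x hx, hyperEig]
  -- The derivative of `σ^j` contains `σ^(j-1)`, with truncated subtraction at `j = 0`.
  rcases j with _ | j
  · simp; ring
  · simp only [Nat.add_sub_cancel]; push_cast; ring

theorem IsHypergeometric.iteratedDeriv_rodrigues (h : S.IsHypergeometric σ τ s t lam) (k j : ℕ)
    {f : ℝ → ℂ} (hf : ContDiffOn ℝ ((j + 2 : ℕ) : WithTop ℕ∞) f S.I) :
    Set.EqOn (iteratedDeriv (k + 1) (S.rodrigues σ (j + 1) f))
      (iteratedDeriv k (S.rodrigues σ j (hyperOp σ τ (hyperEig s t j) f))) S.I := by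
  rw [iteratedDeriv_succ']
  exact (h.deriv_rodrigues j hf).iteratedDeriv_of_isOpen S.isOpen_I k

/-- The Newton basis polynomials at the nodes `hyperEig s t i`. -/
def newtonBasis (s t : ℂ) (j : ℕ) : ℂ[X] := ∏ i ∈ Finset.range j, (X - C (hyperEig s t i))

theorem IsHypergeometric.iteratedDeriv_rodrigues_polyFun (h : S.IsHypergeometric σ τ s t lam)
    (j : ℕ) (Q : ℂ[X]) : Set.EqOn (iteratedDeriv j (S.rodrigues σ j (polyFun Q)))
      (fun x => S.w x * polyFun (aeval (polyHyper σ τ) (newtonBasis s t j) Q) x) S.I := by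
  induction j generalizing Q with
  | zero => intro x _; simp [rodrigues, newtonBasis]
  | succ j ih =>
    refine (h.iteratedDeriv_rodrigues j j (contDiff_polyFun _ Q).contDiffOn).trans ?_
    rw [hyperOp_polyFun]
    refine (ih _).trans fun x _ => ?_
    have : newtonBasis s t (j + 1) = newtonBasis s t j * (X - C (hyperEig s t j)) := by
      rw [newtonBasis, Finset.prod_range_succ, newtonBasis]
    simp only [this, map_mul, map_sub, aeval_X, aeval_C, Module.End.mul_apply]
    simp [← smul_eq_C_mul, Module.algebraMap_end_apply]

/-! ### Newton expansion and uniqueness of the Lagrangian form -/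

theorem exists_newton_expansion (s t lam : ℂ) (m : ℕ) : ∃ d : ℕ → ℂ,
    (C lam - X) ^ m = ∑ j ∈ Finset.range (m + 1), C (d j) * newtonBasis s t j := by
  induction m with
  | zero => exact ⟨fun _ => 1, by simp [newtonBasis]⟩
  | succ m ih =>
    obtain ⟨d, hd⟩ := ih
    -- From `(λ - X) N_j = (λ - μ_j) N_j - N_(j+1)`; the cutoff is there because `d` is arbitrary
    -- beyond `m`.
    refine ⟨fun j => (if j ≤ m then (lam - hyperEig s t j) * d j else 0) -
      (if j = 0 then 0 else d (j - 1)), ?_⟩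
    have h1 : ∀ j, (C lam - X) * (C (d j) * newtonBasis s t j) =
        C (d j) * (C (lam - hyperEig s t j) * newtonBasis s t j) -
          C (d j) * newtonBasis s t (j + 1) := fun j => by
      rw [newtonBasis, newtonBasis, Finset.prod_range_succ]
      simp only [C_sub]; ring
    simp only [C_sub, sub_mul (C _) (C _), Finset.sum_sub_distrib]
    rw [Finset.sum_range_succ, Finset.sum_range_succ' (fun j => C (if j = 0 then 0 else d (j - 1)) *
      newtonBasis s t j), pow_succ', hd, Finset.mul_sum, ← sub_eq_zero]
    simp only [h1, Finset.sum_sub_distrib]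
    rw [Finset.sum_congr rfl (g := fun j => C (d j) * (C (lam - hyperEig s t j) * newtonBasis s t j))
      (s₁ := Finset.range (m + 1)) (f := fun j => C (if j ≤ m then (lam - hyperEig s t j) * d j else 0)
      * newtonBasis s t j)]
    · simp only [Nat.not_succ_le_self, Nat.add_one_ne_zero, ↓reduceIte, Nat.add_sub_cancel, C_0,
        zero_mul, add_zero, sub_self]
    · intro j hj
      rw [if_pos (by simpa [Nat.lt_succ_iff] using hj), C_mul]; ring

/-- Testing with `(X - x)^(2m)` at the point `x` itself: every derivative of order below `2m`
vanishes there, so only the leading term of order `m` survives. The coefficients are removed from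
the top down. -/
theorem eqOn_zero_of_lagrangian_eq_zero {U : Set ℝ} (hU : IsOpen U) (n : ℕ) (B : ℕ → ℝ → ℂ)
    (hB : ∀ j ≤ n, ContDiffOn ℝ j (B j) U)
    (h : ∀ Q : ℂ[X], ∀ x ∈ U, ∑ j ∈ Finset.range (n + 1),
      iteratedDeriv j (fun y => B j y * iteratedDeriv j (polyFun Q) y) x = 0) :
    ∀ j ≤ n, ∀ x ∈ U, B j x = 0 := by
  have key : ∀ j ≤ n, ∀ m, j ≤ m → ∀ x ∈ U,
      iteratedDeriv j (fun y => B j y * iteratedDeriv j (polyFun ((X - C (x : ℂ)) ^ (2 * m))) y) x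
        = if j = m then B j x * (2 * m).factorial else 0 := by
    intro j hj m hjm x hx
    rw [iteratedDeriv_fun_mul ((hB j hj).contDiffAt (hU.mem_nhds hx))
      (by rw [iteratedDeriv_polyFun]; exact (contDiff_polyFun _ _).contDiffAt),
      Finset.sum_eq_single_of_mem 0 (by simp)]
    · rw [iteratedDeriv_polyFun, iteratedDeriv_polyFun, ← Function.iterate_add_apply]
      simp only [polyFun, iterate_derivative_X_sub_pow]
      split_ifs with hm
      · subst hm
        simp [← two_mul, Nat.descFactorial_self]
      · simp [show 2 * m - (j + j) ≠ 0 by omega]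
    · intro i hi hi0
      rw [iteratedDeriv_polyFun, iteratedDeriv_polyFun, ← Function.iterate_add_apply]
      simp only [polyFun, iterate_derivative_X_sub_pow]
      have : 2 * m - (j - i + j) ≠ 0 := by simp at hi; omega
      simp [this]
  induction n with
  | zero =>
    intro j hj x hx
    obtain rfl : j = 0 := by omega
    simpa [polyFun] using h 1 x hx
  | succ n ih =>
    have htop : ∀ x ∈ U, B (n + 1) x = 0 := fun x hx => by
      have := h ((X - C (x : ℂ)) ^ (2 * (n + 1))) x hx
      rw [Finset.sum_congr rfl fun j hj => key j (by simp at hj; omega) (n + 1)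
        (by simp at hj; omega) x hx] at this
      simpa [Nat.factorial_ne_zero] using this
    intro j hj x hx
    rcases hj.lt_or_eq with hlt | rfl
    · refine ih (fun j hj => hB j (by omega)) (fun Q x hx => ?_)
        (fun j hj => key j (by omega)) j (by omega) x hx
      have := h Q x hx
      rw [Finset.sum_range_succ] at this
      have e : Set.EqOn (fun y => B (n + 1) y * iteratedDeriv (n + 1) (polyFun Q) y)
        (fun _ => 0) U := fun y hy => by simp [htop y hy]
      rw [e.iteratedDeriv_of_isOpen hU (n + 1) hx] at this
      simpa using this
    · exact htop x hx

/-! ### From almost everywhere to pointwise equations -/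

variable {n : ℕ}

theorem IsRegular.continuousOn_w (hS : S.IsRegular n) : ContinuousOn S.w S.I :=
  hS.w_smooth.continuousOn

theorem IsRegular.aemeasurable_w (hS : S.IsRegular n) :
    AEMeasurable (fun x => ENNReal.ofReal (S.w x)) (volume.restrict S.I) :=
  (hS.continuousOn_w.aemeasurable S.isOpen_I.measurableSet).ennreal_ofReal

theorem IsRegular.ae_restrict_of_ae (hS : S.IsRegular n) {r : ℝ → Prop}
    (h : ∀ᵐ x ∂S.μ, r x) : ∀ᵐ x ∂(volume.restrict S.I), r x := by
  filter_upwards [(ae_withDensity_iff' hS.aemeasurable_w).1 h,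
    ae_restrict_mem S.isOpen_I.measurableSet] with x hx hxI
  exact hx (by simpa using hS.w_pos x hxI)

theorem ae_mem_I (S : SLExpr) : ∀ᵐ x ∂S.μ, x ∈ S.I :=
  (withDensity_absolutelyContinuous _ _).ae_le (ae_restrict_mem S.isOpen_I.measurableSet)

theorem IsRegular.eqOn_of_ae_eq (hS : S.IsRegular n) {f g : ℝ → ℂ} (h : f =ᵐ[S.μ] g)
    (hf : ContinuousOn f S.I) (hg : ContinuousOn g S.I) : Set.EqOn f g S.I :=
  Measure.eqOn_open_of_ae_eq (hS.ae_restrict_of_ae h) S.isOpen_I hf hg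

theorem _root_.Set.EqOn.ell {f g : ℝ → ℂ} (h : Set.EqOn f g S.I) :
    Set.EqOn (S.ell f) (S.ell g) S.I := by
  have h1 : Set.EqOn (deriv f) (deriv g) S.I := by
    simpa using h.iteratedDeriv_of_isOpen S.isOpen_I 1
  have h2 : Set.EqOn (fun y => (S.p y : ℂ) * deriv f y) (fun y => (S.p y : ℂ) * deriv g y) S.I :=
    fun x hx => by simp only [h1 hx]
  have h3 := h2.iteratedDeriv_of_isOpen S.isOpen_I 1
  simp only [iteratedDeriv_one] at h3
  intro x hx
  simp only [SLExpr.ell, h3 hx, h hx]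

theorem _root_.Set.EqOn.ellPow (m : ℕ) {f g : ℝ → ℂ} (h : Set.EqOn f g S.I) :
    Set.EqOn (S.ellPow m f) (S.ellPow m g) S.I := by
  induction m generalizing f g with
  | zero => exact h
  | succ m ih => exact ih h.ell

theorem IsRegular.contDiffOn_p (hS : S.IsRegular n) :
    ContDiffOn ℝ ((2 * n - 1 : ℕ) : WithTop ℕ∞) (fun x => (S.p x : ℂ)) S.I :=
  Complex.ofRealCLM.contDiff.comp_contDiffOn hS.p_smooth

/-- `L` acts through some representative in `Dmax 1`; since `w > 0`, a continuous representative
agrees with it on all of `I`. -/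
theorem ae_eq_ell_of_mem_graph (hS : S.IsRegular n) {L : S.H →ₗ.[ℂ] S.H}
    (hL : (L.graph : Set (S.H × S.H)) ⊆ S.opGraph 1 (S.Dmax 1)) {u v : S.H} (huv : (u, v) ∈ L.graph)
    {f : ℝ → ℂ} (hf : ContinuousOn f S.I) (hu : u =ᵐ[S.μ] f) :
    v =ᵐ[S.μ] S.ell f ∧ ∃ g ∈ S.Dmax 1, Set.EqOn g f S.I := by
  obtain ⟨g, hg, h1, h2⟩ := hL huv
  have hgc : ContinuousOn g S.I := by simpa using (hg.1 0 (by norm_num)).continuousOn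
  have e : Set.EqOn g f S.I := hS.eqOn_of_ae_eq (h1.symm.trans hu) hgc hf
  refine ⟨?_, g, hg, e⟩
  filter_upwards [h2, S.ae_mem_I] with x hx hxI
  exact hx.trans (e.ell hxI)

theorem deriv_p_mul_polyFun (hn : 1 ≤ n) (hS : S.IsRegular n) (Q : ℂ[X]) {x : ℝ} (hx : x ∈ S.I) :
    deriv (fun y => (S.p y : ℂ) * deriv (polyFun Q) y) x =
      deriv (fun y => (S.p y : ℂ)) x * polyFun (derivative Q) x +
        S.p x * polyFun (derivative (derivative Q)) x := by
  have hp : DifferentiableAt ℝ (fun y => (S.p y : ℂ)) x :=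
    (hS.contDiffOn_p.differentiableOn (by norm_cast; omega)).differentiableAt
      (S.isOpen_I.mem_nhds hx)
  rw [deriv_polyFun]
  exact (hp.hasDerivAt.mul (hasDerivAt_polyFun _ x)).deriv

theorem continuousOn_ell_polyFun (hn : 1 ≤ n) (hS : S.IsRegular n) (Q : ℂ[X]) :
    ContinuousOn (S.ell (polyFun Q)) S.I := by
  have hw : ContinuousOn (fun x => (S.w x : ℂ)) S.I :=
    Complex.continuous_ofReal.comp_continuousOn hS.continuousOn_w
  have hq : ContinuousOn (fun x => (S.q x : ℂ)) S.I :=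
    Complex.continuous_ofReal.comp_continuousOn hS.q_smooth.continuousOn
  have hp' : ContinuousOn (deriv fun x => (S.p x : ℂ)) S.I :=
    hS.contDiffOn_p.continuousOn_deriv_of_isOpen S.isOpen_I (by norm_cast; omega)
  have hd : ContinuousOn (deriv (fun y => (S.p y : ℂ) * deriv (polyFun Q) y)) S.I :=
    ((hp'.mul (continuous_polyFun _).continuousOn).add (hS.contDiffOn_p.continuousOn.mul
      (continuous_polyFun _).continuousOn)).congr fun x hx => deriv_p_mul_polyFun hn hS Q hx
  exact ((continuousOn_const.div hw fun x hx => by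
    exact_mod_cast (hS.w_pos x hx).ne').neg).mul
      (hd.add (hq.mul (continuous_polyFun Q).continuousOn))

theorem exists_eigenvalue_equation (hn : 1 ≤ n) (hS : S.IsRegular n) {L : S.H →ₗ.[ℂ] S.H}
    (hL : (L.graph : Set (S.H × S.H)) ⊆ S.opGraph 1 (S.Dmax 1)) {Q : ℂ[X]} {e : S.H}
    (he : e =ᵐ[S.μ] polyFun Q) {l : ℂ} (hl : (e, l • e) ∈ L.graph) {x : ℝ} (hx : x ∈ S.I) :
    deriv (fun y => (S.p y : ℂ)) x * polyFun (derivative Q) x +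
        S.p x * polyFun (derivative (derivative Q)) x + S.q x * polyFun Q x =
      -l * S.w x * polyFun Q x := by
  have h1 := (ae_eq_ell_of_mem_graph hS hL hl (continuous_polyFun Q).continuousOn he).1
  have h2 : S.ell (polyFun Q) =ᵐ[S.μ] fun x => l * polyFun Q x := by
    filter_upwards [h1, Lp.coeFn_smul l e, he] with x h1 h2 h3
    rw [← h1, h2, Pi.smul_apply, h3, smul_eq_mul]
  have h3 := hS.eqOn_of_ae_eq h2 (continuousOn_ell_polyFun hn hS Q)
    (continuous_const.mul (continuous_polyFun Q)).continuousOn hx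
  have hw : (S.w x : ℂ) ≠ 0 := by exact_mod_cast (hS.w_pos x hx).ne'
  simp only [ell, deriv_p_mul_polyFun hn hS Q hx] at h3
  field_simp at h3
  linear_combination -h3

/-! ### The hypergeometric form of `ℓ` and its Lagrangian coefficients -/

theorem exists_isHypergeometric (hn : 1 ≤ n) (hS : S.IsRegular n) {L : S.H →ₗ.[ℂ] S.H}
    (hL : (L.graph : Set (S.H × S.H)) ⊆ S.opGraph 1 (S.Dmax 1)) {P : ℕ → ℂ[X]}
    (hP : S.IsPolynomialEigensystem L P) :
    ∃ (σ τ : ℂ[X]) (s t lam : ℂ), S.IsHypergeometric σ τ s t lam ∧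
      ∃ (e : S.H) (c : ℂ), c ≠ 0 ∧ e =ᵐ[S.μ] (fun _ => c) ∧ (e, lam • e) ∈ L.graph := by
  obtain ⟨hdeg, e, he, hlam, -, -⟩ := hP
  choose lam hlam using hlam
  have ode := fun k x (hx : x ∈ S.I) => exists_eigenvalue_equation hn hS hL (he k) (hlam k) hx
  have hne : ∀ k, (P k).coeff k ≠ 0 := fun k => coeff_ne_zero_of_eq_degree (hdeg k)
  have P0 : P 0 = C ((P 0).coeff 0) := eq_C_of_degree_eq_zero (by simpa using hdeg 0)
  have P1 : P 1 = C ((P 1).coeff 1) * X + C ((P 1).coeff 0) :=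
    eq_X_add_C_of_degree_le_one (hdeg 1).le
  have P2 := eq_quadratic_of_degree_le_two (p := P 2) (hdeg 2).le
  set c := (P 0).coeff 0
  set a₁ := (P 1).coeff 1
  set b₁ := (P 1).coeff 0
  set a₂ := (P 2).coeff 2
  set b₂ := (P 2).coeff 1
  set c₂ := (P 2).coeff 0
  have hc : c ≠ 0 := hne 0
  have ha₁ : a₁ ≠ 0 := hne 1
  have ha₂ : a₂ ≠ 0 := hne 2
  have dP0 : derivative (P 0) = 0 := by rw [P0]; simp
  have dP1 : derivative (P 1) = C a₁ := by rw [P1]; simp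
  have dP2 : derivative (P 2) = C (2 * a₂) * X + C b₂ := by
    rw [P2]
    simp only [derivative_add, derivative_C_mul, derivative_X_sq, derivative_X, derivative_C, C_mul]
    ring
  have hq : ∀ x ∈ S.I, (S.q x : ℂ) = -lam 0 * S.w x := fun x hx => by
    have := ode 0 x hx
    rw [dP0, P0] at this
    simp only [derivative_zero, polyFun, eval_zero, eval_C, mul_zero, zero_add] at this
    exact mul_right_cancel₀ hc this
  -- `τ` and `σ` are the equations of degrees 1 and 2 solved for `p'/w` and `p/w`.
  set τ : ℂ[X] := C ((lam 0 - lam 1) / a₁) * P 1 with hτ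
  set σ : ℂ[X] := C (1 / (2 * a₂)) * (C (lam 0 - lam 2) * P 2 - τ * derivative (P 2)) with hσ
  have hp' : ∀ x ∈ S.I, deriv (fun y => (S.p y : ℂ)) x = polyFun τ x * S.w x := fun x hx => by
    have := ode 1 x hx
    rw [dP1, hq x hx] at this
    simp only [derivative_C, polyFun, eval_zero, eval_C, mul_zero, add_zero] at this
    simp only [hτ, polyFun, eval_mul, eval_C]
    field_simp
    linear_combination this
  have dτ : derivative τ = C (lam 0 - lam 1) := by
    rw [hτ, derivative_C_mul, dP1, ← C_mul, div_mul_cancel₀ _ ha₁]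
  refine ⟨σ, τ, (lam 0 - lam 2) - 2 * (lam 0 - lam 1), lam 0 - lam 1, lam 0,
    ⟨?_, dτ, fun x hx => ?_, fun x hx => ?_, hq⟩, e 0, c, hc, ?_, hlam 0⟩
  · have : derivative (derivative σ) = C (1 / (2 * a₂)) *
        (C (lam 0 - lam 2) * C (2 * a₂) - 2 * C (lam 0 - lam 1) * C (2 * a₂)) := by
      rw [hσ]
      simp only [derivative_sub, derivative_mul, derivative_add, dτ, dP2, derivative_C,
        derivative_X, derivative_zero, derivative_one]
      ring
    rw [this, ← C_ofNat, ← C_mul, ← C_mul, ← C_mul, ← C_sub, ← C_mul]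
    congr 1
    field_simp
  · have := ode 2 x hx
    rw [hp' x hx, hq x hx, dP2] at this
    simp only [hσ, dP2]
    simp only [derivative_add, derivative_C_mul, derivative_C, derivative_X, polyFun, eval_mul,
      eval_add, eval_sub, eval_C, eval_X, mul_one, add_zero] at this ⊢
    field_simp
    linear_combination this
  · rw [← hp' x hx]
    exact ((hS.contDiffOn_p.differentiableOn (by norm_cast; omega)).differentiableAt
      (S.isOpen_I.mem_nhds hx)).hasDerivAt
  · refine (he 0).trans (Eventually.of_forall fun x => ?_)
    rw [P0]
    simp [polyFun]

theorem IsHypergeometric.ell_eq (h : S.IsHypergeometric σ τ s t lam) (hS : S.IsRegular n)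
    {f : ℝ → ℂ} (hf : ContDiffOn ℝ 2 f S.I) (m : ℂ) :
    Set.EqOn (hyperOp σ τ m f) (fun x => (lam - m) * f x - S.ell f x) S.I := by
  intro x hx
  have hw : (S.w x : ℂ) ≠ 0 := by exact_mod_cast (hS.w_pos x hx).ne'
  have hd : DifferentiableAt ℝ (deriv f) x :=
    ((hf.deriv_of_isOpen S.isOpen_I (m := 1) (by norm_num)).differentiableOn
      (by simp)).differentiableAt (S.isOpen_I.mem_nhds hx)
  have := ((h.deriv_p x hx).mul hd.hasDerivAt).deriv
  have e : deriv (fun y => (S.p y : ℂ) * deriv f y) x =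
    polyFun τ x * S.w x * deriv f x + S.p x * deriv (deriv f) x := this
  simp only [hyperOp, ell, e, h.p_eq x hx, h.q_eq x hx]
  field_simp
  ring

theorem IsHypergeometric.ellPow_polyFun (h : S.IsHypergeometric σ τ s t lam) (hS : S.IsRegular n)
    (m : ℕ) (Q : ℂ[X]) : Set.EqOn (S.ellPow m (polyFun Q))
      (polyFun (aeval (polyHyper σ τ) ((C lam - X) ^ m) Q)) S.I := by
  induction m generalizing Q with
  | zero => intro x _; simp [ellPow]
  | succ m ih =>
    have e : Set.EqOn (S.ell (polyFun Q)) (polyFun (aeval (polyHyper σ τ) (C lam - X) Q)) S.I := by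
      intro x hx
      have := h.ell_eq hS (contDiff_polyFun 2 Q).contDiffOn 0 hx
      rw [hyperOp_polyFun] at this
      simp only [polyFun, sub_zero, C_0, zero_mul] at this
      simp only [polyFun, map_sub, aeval_C, aeval_X, LinearMap.sub_apply,
        Module.algebraMap_end_apply, eval_sub, eval_smul, smul_eq_mul]
      rw [this]
      simp
    refine (e.ellPow m).trans ?_
    rw [pow_succ, map_mul, Module.End.mul_apply]
    exact ih _

theorem admissible_polyFun (S : SLExpr) (m : ℕ) (Q : ℂ[X]) : S.Admissible m (polyFun Q) :=
  fun k _ => by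
    rw [iteratedDeriv_polyFun]
    exact (contDiff_polyFun 1 _).contDiffOn.ACloc

/-- For `j ≥ 1` the function is `σ^(j-1) p`, so the smoothness of `p` suffices. -/
theorem IsHypergeometric.contDiffOn_sigma_pow_mul_w (h : S.IsHypergeometric σ τ s t lam)
    (hS : S.IsRegular n) {j : ℕ} (hj : j ≤ n) :
    ContDiffOn ℝ j (fun x => polyFun σ x ^ j * S.w x) S.I := by
  rcases j with _ | j
  · simpa [Function.comp_def] using
      Complex.continuous_ofReal.comp_continuousOn hS.continuousOn_w
  · refine (((contDiff_polyFun _ σ).pow j).contDiffOn.mul (hS.contDiffOn_p.of_le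
      (by norm_cast; omega))).congr fun x hx => ?_
    rw [h.p_eq x hx]; ring

/-- On polynomials both the given coefficients and the Newton coefficients represent `w ℓⁿ`; their
difference is a Lagrangian form that vanishes on all polynomials. -/
theorem IsHypergeometric.exists_lagrangian_coeff (h : S.IsHypergeometric σ τ s t lam)
    (hS : S.IsRegular n) {A : ℕ → ℝ → ℝ} (hA : S.IsLagrangianForm n A) :
    ∃ d : ℕ → ℂ, ∀ j ≤ n, ∀ x ∈ S.I, (A j x : ℂ) = d j * (polyFun σ x ^ j * S.w x) := by
  obtain ⟨d, hd⟩ := exists_newton_expansion s t lam n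
  have hU := S.isOpen_I
  have hAc : ∀ j ≤ n, ContDiffOn ℝ j (fun x => (A j x : ℂ)) S.I := fun j hj =>
    Complex.ofRealCLM.contDiff.comp_contDiffOn (hA.1 j hj)
  have hAQ : ∀ j ≤ n, ∀ Q : ℂ[X],
      ContDiffOn ℝ j (fun y => (A j y : ℂ) * iteratedDeriv j (polyFun Q) y) S.I := fun j hj Q => by
    rw [iteratedDeriv_polyFun]
    exact (hAc j hj).mul (contDiff_polyFun _ _).contDiffOn
  have hwc : ContinuousOn (fun x => (S.w x : ℂ)) S.I :=
    Complex.continuous_ofReal.comp_continuousOn hS.continuousOn_w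
  have hform : ∀ Q : ℂ[X], Set.EqOn
      (fun x => (S.w x : ℂ) * polyFun (aeval (polyHyper σ τ) ((C lam - X) ^ n) Q) x)
      (fun x => ∑ j ∈ Finset.range (n + 1), (-1) ^ j *
        iteratedDeriv j (fun y => (A j y : ℂ) * iteratedDeriv j (polyFun Q) y) x) S.I := by
    intro Q
    refine Measure.eqOn_open_of_ae_eq (μ := volume) ?_ hU
      (hwc.mul (continuous_polyFun _).continuousOn) ?_
    · filter_upwards [hA.2 _ (S.admissible_polyFun n Q), ae_restrict_mem hU.measurableSet]
        with x hx hxI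
      rw [← hx, h.ellPow_polyFun hS n Q hxI]
    · refine continuousOn_finsetSum _ fun j hj => continuousOn_const.mul ?_
      exact (ContDiffOn.iteratedDeriv_of_isOpen hU j 0
        (hAQ j (by simpa [Nat.lt_succ_iff] using hj) Q)).continuousOn
  refine ⟨fun j => (-1) ^ j * d j, fun j hj x hx => ?_⟩
  have := eqOn_zero_of_lagrangian_eq_zero hU n
    (fun j x => (-1) ^ j * (A j x : ℂ) - d j * (polyFun σ x ^ j * S.w x))
    (fun j hj => (contDiffOn_const.mul (hAc j hj)).sub
      (contDiffOn_const.mul (h.contDiffOn_sigma_pow_mul_w hS hj))) ?_ j hj x hx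
  · have h1 : ((-1 : ℂ) ^ j) * (-1) ^ j = 1 := by rw [← mul_pow]; simp
    linear_combination (-1) ^ j * this - (A j x : ℂ) * h1
  · intro Q x hx
    have hr : ∀ j ≤ n, ContDiffOn ℝ j (S.rodrigues σ j (polyFun Q)) S.I := fun j hj => by
      refine (h.contDiffOn_sigma_pow_mul_w hS hj).mul ?_
      rw [iteratedDeriv_polyFun]
      exact (contDiff_polyFun _ _).contDiffOn
    have e : ∀ j ∈ Finset.range (n + 1), iteratedDeriv j (fun y => ((-1) ^ j * (A j y : ℂ) -
        d j * (polyFun σ y ^ j * S.w y)) * iteratedDeriv j (polyFun Q) y) x =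
        (-1) ^ j * iteratedDeriv j (fun y => (A j y : ℂ) * iteratedDeriv j (polyFun Q) y) x -
        S.w x * polyFun (aeval (polyHyper σ τ) (C (d j) * newtonBasis s t j) Q) x := by
      intro j hj
      have hj : j ≤ n := by simpa [Nat.lt_succ_iff] using hj
      have : (fun y => ((-1) ^ j * (A j y : ℂ) - d j * (polyFun σ y ^ j * S.w y)) *
          iteratedDeriv j (polyFun Q) y) =
          (fun y => (-1) ^ j * ((A j y : ℂ) * iteratedDeriv j (polyFun Q) y)) -
          (fun y => d j * S.rodrigues σ j (polyFun Q) y) := by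
        funext y; simp only [rodrigues, Pi.sub_apply]; ring
      rw [this, iteratedDeriv_sub
        ((contDiffOn_const.mul (hAQ j hj Q)).contDiffAt (hU.mem_nhds hx))
        ((contDiffOn_const.mul (hr j hj)).contDiffAt (hU.mem_nhds hx)),
        iteratedDeriv_const_mul_field, iteratedDeriv_const_mul_field,
        h.iteratedDeriv_rodrigues_polyFun j Q hx]
      simp only [map_mul, aeval_C, Module.End.mul_apply, Module.algebraMap_end_apply, polyFun,
        eval_smul, smul_eq_mul]
      ring
    rw [Finset.sum_congr rfl e, Finset.sum_sub_distrib, ← Finset.mul_sum]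
    refine (congrArg (· - _) (hform Q hx).symm).trans ?_
    simp only [hd, map_sum, polyFun, LinearMap.sum_apply, eval_finsetSum]
    ring

/-! ### Boundary terms from self-adjointness -/

theorem _root_.IsSelfAdjoint.inner_graph {H : Type*} [NormedAddCommGroup H]
    [InnerProductSpace ℂ H] [CompleteSpace H] {L : H →ₗ.[ℂ] H} (hL : IsSelfAdjoint L)
    {x x' y y' : H} (hx : (x, x') ∈ L.graph) (hy : (y, y') ∈ L.graph) :
    inner ℂ x' y = inner ℂ x y' := by
  have h := L.adjoint_isFormalAdjoint hL.dense_domain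
  rw [LinearPMap.isSelfAdjoint_def.1 hL] at h
  obtain ⟨a, rfl, rfl⟩ := LinearPMap.mem_graph_iff L |>.1 hx
  obtain ⟨b, rfl, rfl⟩ := LinearPMap.mem_graph_iff L |>.1 hy
  exact h a b

theorem IsHypergeometric.bdryVanishes_p_mul_deriv (h : S.IsHypergeometric σ τ s t lam)
    (hn : 1 ≤ n) (hS : S.IsRegular n) {L : S.H →ₗ.[ℂ] S.H} (hsa : IsSelfAdjoint L)
    (hL : (L.graph : Set (S.H × S.H)) ⊆ S.opGraph 1 (S.Dmax 1)) {e : S.H} {c : ℂ} (hc : c ≠ 0)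
    (he : e =ᵐ[S.μ] fun _ => c) (hel : (e, lam • e) ∈ L.graph) {f : ℝ → ℂ}
    (hf : ContinuousOn f S.I) {u v : S.H} (hu : u =ᵐ[S.μ] f) (huv : (u, v) ∈ L.graph) :
    S.BdryVanishes (fun x => S.p x * deriv f x) := by
  obtain ⟨hv, g, hg, hgf⟩ := ae_eq_ell_of_mem_graph hS hL huv hf hu
  -- `λ = -q/w` is real.
  have hlam : (starRingEnd ℂ) lam = lam := by
    obtain ⟨x, hx⟩ := hS.nonempty_I
    have hw : (S.w x : ℂ) ≠ 0 := by exact_mod_cast (hS.w_pos x hx).ne'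
    have h1 := h.q_eq x hx
    have h2 := congrArg (starRingEnd ℂ) h1
    simp only [map_mul, map_neg, Complex.conj_ofReal] at h2
    exact neg_injective (mul_right_cancel₀ hw (h2.symm.trans h1))
  have horth : inner ℂ e (lam • u - v) = 0 := by
    rw [inner_sub_right, ← hsa.inner_graph hel huv, inner_smul_left, inner_smul_right, hlam,
      sub_self]
  have hae : (fun x => inner ℂ (e x) ((lam • u - v : S.H) x)) =ᵐ[S.μ]
      fun x => (starRingEnd ℂ) c * (lam * f x - S.ell f x) := by
    filter_upwards [he, hu, hv, Lp.coeFn_sub (lam • u) v, Lp.coeFn_smul lam u]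
      with x h1 h2 h3 h4 h5
    rw [h4, Pi.sub_apply, h5, Pi.smul_apply, h1, h2, h3, RCLike.inner_apply, smul_eq_mul]
    ring
  have hint : Integrable (fun x => lam * f x - S.ell f x) S.μ :=
    (integrable_const_mul_iff (by simpa using hc : IsUnit ((starRingEnd ℂ) c)) _).1
      ((L2.integrable_inner e (lam • u - v)).congr hae)
  have hzero : ∫ x, (lam * f x - S.ell f x) ∂S.μ = 0 := by
    rw [L2.inner_def, integral_congr_ae hae, integral_const_mul] at horth
    exact (mul_eq_zero.1 horth).resolve_left (by simpa using hc)
  rw [μ, integrable_withDensity_iff_integrable_smul₀' hS.aemeasurable_w (by simp)] at hint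
  rw [μ, integral_withDensity_eq_integral_toReal_smul₀ hS.aemeasurable_w (by simp)] at hzero
  have hd : ∀ᵐ x ∂(volume.restrict S.I), (ENNReal.ofReal (S.w x)).toReal •
      (lam * f x - S.ell f x) = deriv (fun y => (S.p y : ℂ) * deriv g y) x := by
    filter_upwards [ae_restrict_mem S.isOpen_I.measurableSet] with x hx
    have hw : (S.w x : ℂ) ≠ 0 := by exact_mod_cast (hS.w_pos x hx).ne'
    rw [ENNReal.toReal_ofReal (hS.w_pos x hx).le, Complex.real_smul, ← hgf hx, ← hgf.ell hx, ell,
      h.q_eq x hx]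
    field_simp
    ring
  have hac : S.ACloc (fun x => (S.p x : ℂ) * deriv g x) := by
    refine ACloc.mul (hS.contDiffOn_p.of_le (by norm_cast; omega)).ACloc ?_
    simpa using hg.1 1 (by norm_num)
  refine (bdryVanishes_of_integral_deriv_eq_zero hS.nonempty_I hac (hint.congr hd)
    ((integral_congr_ae hd).symm.trans hzero)).congr hS.nonempty_I fun x hx => ?_
  have := hgf.iteratedDeriv_of_isOpen S.isOpen_I 1 hx
  simp only [iteratedDeriv_one] at this
  simp only [this]

theorem powGraph_smul_sub {L : S.H →ₗ.[ℂ] S.H} (m : ℕ) (a : ℂ) {z z' : S.H × S.H}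
    (hz : z ∈ S.powGraph L m) (hz' : z' ∈ S.powGraph L m) : a • z - z' ∈ S.powGraph L m := by
  induction m generalizing z z' with
  | zero =>
    have h1 : z.1 = z.2 := hz
    have h2 : z'.1 = z'.2 := hz'
    show a • z.1 - z'.1 = a • z.2 - z'.2
    rw [h1, h2]
  | succ m ih =>
    obtain ⟨u, h1, h2⟩ := hz
    obtain ⟨u', h1', h2'⟩ := hz'
    exact ⟨a • u - u', ih h1 h1', L.graph.sub_mem (L.graph.smul_mem a h2) h2'⟩

/-- `powGraph` splits off the last application of `L`; the induction on boundary terms needs the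
first. -/
theorem exists_of_mem_powGraph_succ {L : S.H →ₗ.[ℂ] S.H} (m : ℕ) {u v : S.H}
    (h : (u, v) ∈ S.powGraph L (m + 1)) :
    ∃ u₁, (u, u₁) ∈ L.graph ∧ (u₁, v) ∈ S.powGraph L m := by
  induction m generalizing v with
  | zero =>
    obtain ⟨u', h1, h2⟩ := h
    obtain rfl : u = u' := h1
    exact ⟨v, h2, rfl⟩
  | succ m ih =>
    obtain ⟨u', h1, h2⟩ := h
    obtain ⟨u₁, h3, h4⟩ := ih h1
    exact ⟨u₁, h3, u', h4, h2⟩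

theorem exists_mem_powGraph_of_le {L : S.H →ₗ.[ℂ] S.H} {m k : ℕ} (hmk : m ≤ k) {u v : S.H}
    (h : (u, v) ∈ S.powGraph L k) : ∃ v', (u, v') ∈ S.powGraph L m := by
  induction k, hmk using Nat.le_induction generalizing v with
  | base => exact ⟨v, h⟩
  | succ k _ ih =>
    obtain ⟨u', h1, -⟩ := h
    exact ih h1

/-- Each use of the Rodrigues-type identity trades one derivative for a factor `λ - μ - L` on `f`,
at the cost of one power of `L`, down to the case of `p f'`. -/
theorem IsHypergeometric.bdryVanishes_iteratedDeriv_rodrigues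
    (h : S.IsHypergeometric σ τ s t lam)
    (hn : 1 ≤ n) (hS : S.IsRegular n) {L : S.H →ₗ.[ℂ] S.H} (hsa : IsSelfAdjoint L)
    (hL : (L.graph : Set (S.H × S.H)) ⊆ S.opGraph 1 (S.Dmax 1)) {e : S.H} {c : ℂ} (hc : c ≠ 0)
    (he : e =ᵐ[S.μ] fun _ => c) (hel : (e, lam • e) ∈ L.graph) (j : ℕ) {f : ℝ → ℂ}
    (hf : ContDiffOn ℝ ((2 * j + 1 : ℕ) : WithTop ℕ∞) f S.I) {u v : S.H} (hu : u =ᵐ[S.μ] f)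
    (huv : (u, v) ∈ S.powGraph L (j + 1)) :
    S.BdryVanishes (iteratedDeriv j (S.rodrigues σ (j + 1) f)) := by
  induction j generalizing f u v with
  | zero =>
    obtain ⟨u', h1, h2⟩ := huv
    obtain rfl : u = u' := h1
    refine (h.bdryVanishes_p_mul_deriv hn hS hsa hL hc he hel hf.continuousOn hu h2).congr
      hS.nonempty_I fun x hx => ?_
    simp [rodrigues, h.p_eq x hx]
  | succ j ih =>
    obtain ⟨u₁, h1, h2⟩ := exists_of_mem_powGraph_succ _ huv
    obtain ⟨v', h3⟩ := exists_mem_powGraph_of_le (Nat.le_succ (j + 1)) huv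
    -- By `ell_eq`, `hyperOp` with this shift is `(λ - μ_(j+1)) f - ℓ[f]`. Both `u` and `u₁ = Lu`
    -- lie in the domain of `L^(j+1)`.
    refine (ih (f := hyperOp σ τ (hyperEig s t (j + 1)) f)
      (u := (lam - hyperEig s t (j + 1)) • u - u₁)
      (contDiffOn_hyperOp S.isOpen_I (hf.of_le (by norm_cast))) ?_
      (powGraph_smul_sub _ (lam - hyperEig s t (j + 1)) h3 h2)).congr hS.nonempty_I
      (h.iteratedDeriv_rodrigues j (j + 1) (hf.of_le (by norm_cast; omega))).symm
    have h4 := (ae_eq_ell_of_mem_graph hS hL h1 hf.continuousOn hu).1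
    filter_upwards [hu, h4, S.ae_mem_I, Lp.coeFn_sub ((lam - hyperEig s t (j + 1)) • u) u₁,
      Lp.coeFn_smul (lam - hyperEig s t (j + 1)) u] with x h5 h6 h7 h8 h9
    rw [h8, Pi.sub_apply, h9, Pi.smul_apply, h5, h6, smul_eq_mul,
      h.ell_eq hS (hf.of_le (by norm_cast; omega)) _ h7]

end SLExpr

/-! ### Conclusion -/

theorem mainTheorem5 (S : SLExpr) (n : ℕ) (hn : 1 ≤ n) (hS : S.IsRegular n)
    (L : S.H →ₗ.[ℂ] S.H) (hL : S.IsLeftDefinitePower L n)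
    (P : ℕ → Polynomial ℂ) (hP : S.IsPolynomialEigensystem L P)
    (A : ℕ → ℝ → ℝ) (hA : S.IsLagrangianForm n A)
    (ρ : ℝ → ℝ) (hρ : ρ = S.p ∨ ρ = fun x => S.p x / S.w x)
    (hDA : S.powDomain L n = S.setA n ρ)
    (hAB : S.setA n ρ = S.setB n P) :
    S.setB n P ⊆ S.setF n A := by
  obtain ⟨σ, τ, s, t, lam, h, e, c, hc, he, hel⟩ := SLExpr.exists_isHypergeometric hn hS hL.acts hP
  obtain ⟨d, hd⟩ := h.exists_lagrangian_coeff hS hA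
  intro f hf
  rw [← hAB, ← hDA] at hf
  obtain ⟨hfD, u, v, hu, huv⟩ := hf
  refine ⟨hfD, fun j hj => ?_⟩
  obtain ⟨hj1, hjn⟩ := Finset.mem_Icc.1 hj
  obtain ⟨i, rfl⟩ := Nat.exists_eq_add_of_le' hj1
  obtain ⟨v', huv'⟩ := SLExpr.exists_mem_powGraph_of_le hjn huv
  -- The lemma needs `2i + 1` continuous derivatives, and `i + 1 ≤ n` gives `2i + 1 ≤ 2n - 1`.
  have hb := h.bdryVanishes_iteratedDeriv_rodrigues hn hS hL.selfAdjoint hL.acts hc he hel i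
    ((hfD.1.contDiffOn hn).of_le (by norm_cast; omega)) hu huv'
  refine (hb.const_mul (d (i + 1))).congr hS.nonempty_I fun x hx => ?_
  have e1 : Set.EqOn (fun y => (A (i + 1) y : ℂ) * iteratedDeriv (i + 1) f y)
      (fun y => d (i + 1) * S.rodrigues σ (i + 1) f y) S.I := fun y hy => by
    simp only [hd _ hjn y hy, SLExpr.rodrigues]; ring
  rw [Nat.add_sub_cancel, e1.iteratedDeriv_of_isOpen S.isOpen_I i hx, iteratedDeriv_const_mul_field]

end
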